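/- A finite abstract simplicial complex is a finite family $K$ of finite sets, closed under taking subsets (so $\emptyset$, of dimension $-1$, is a face of every complex other than the empty one). Let $d \ge 0$ be an integer. A face $\sigma \in K$ is $d$-collapsible if $\dim\sigma = |\sigma|-1 \le d-1$ and there is a unique inclusion-maximal face $\tau(\sigma)$ of $K$ containing $\sigma$ (possibly $\tau(\sigma)=\sigma$). Then $K_\sigma = K \setminus \{\eta \in K : \sigma \subseteq \eta \subseteq \tau(\sigma)\}$ is said to arise from $K$ by an elementary $d$-collapse. The complex $K$ $d$-collapses to $L$ if $L$ is obtained from $K$ by a finite (possibly empty) sequence of elementary $d$-collapses, and $K$ is $d$-collapsible if it $d$-collapses to the empty complex $\emptyset$. A $d$-collapsible face $\sigma$ of $K$ is good if $K_\sigma$ is $d$-collapsible, and bad if $K_\sigma$ is not $d$-collapsible. **Theorem.** (i) Let $d \le 2$. Then every $d$-collapsible face of a $d$-collapsible complex is good. Consequently greedy collapsing always succeeds: if $K$ is $d$-collapsible and $K$ $d$-collapses to $L$, then $L$ is $d$-collapsible. (ii) Let $d \ge 3$. Then there exists a $d$-collapsible complex that contains a bad $d$-collapsible face. -/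

import Mathlib

/-- A finite abstract simplicial complex with vertices in `V`: a finite family of finite sets
that is closed under taking subsets. The empty set is a face (of dimension `-1`) of every complex
other than the empty family. -/
@[ext]
structure FiniteComplex (V : Type*) where
  /-- the faces of the complex -/
  faces : Set (Finset V)
  finite_faces : faces.Finite
  down_closed : ∀ A ∈ faces, ∀ B ⊆ A, B ∈ faces

namespace FiniteComplex

variable {V : Type*}

/-- The empty complex, without any face (not even the empty one). -/
def void (V : Type*) : FiniteComplex V where
  faces := ∅
  finite_faces := Set.finite_empty
  down_closed := fun _ hA => hA.elim

/-- The dimension of a face, as an integer. -/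
def dim (σ : Finset V) : ℤ := (σ.card : ℤ) - 1

/-- `τ` is an inclusionwise-maximal face of `K`. -/
def IsMaximalFace (K : FiniteComplex V) (τ : Finset V) : Prop :=
  τ ∈ K.faces ∧ ∀ η ∈ K.faces, τ ⊆ η → η = τ

/-- `σ` is a collapsible face of `K`: a face contained in a unique maximal face of `K`. -/
def IsCollapsibleFace (K : FiniteComplex V) (σ : Finset V) : Prop :=
  σ ∈ K.faces ∧ ∃! τ, K.IsMaximalFace τ ∧ σ ⊆ τ

/-- `σ` is a `d`-collapsible face of `K`: a collapsible face of dimension at most `d - 1`. -/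
def IsDCollapsibleFace (d : ℕ) (K : FiniteComplex V) (σ : Finset V) : Prop :=
  K.IsCollapsibleFace σ ∧ dim σ ≤ (d : ℤ) - 1

/-- `τ(σ)`: the unique maximal face containing the collapsible face `σ`. -/
noncomputable def tau (K : FiniteComplex V) (σ : Finset V) (h : K.IsCollapsibleFace σ) :
    Finset V :=
  h.2.choose

/-- `[σ, τ]`: the faces of `K` between `σ` and `τ`. -/
def interval (K : FiniteComplex V) (σ τ : Finset V) : Set (Finset V) :=
  {η | η ∈ K.faces ∧ σ ⊆ η ∧ η ⊆ τ}

theorem exists_maximalFace (K : FiniteComplex V) {A : Finset V} (hA : A ∈ K.faces) :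
    ∃ μ, K.IsMaximalFace μ ∧ A ⊆ μ := by
  obtain ⟨μ, hAμ, hμ⟩ := K.finite_faces.exists_le_maximal hA
  exact ⟨μ, ⟨hμ.prop, fun η hη h => (hμ.eq_of_le hη h).symm⟩, hAμ⟩

/-- Every face containing a collapsible face `σ` is contained in `τ(σ)`. -/
theorem subset_tau (K : FiniteComplex V) (σ : Finset V) (h : K.IsCollapsibleFace σ)
    {A : Finset V} (hA : A ∈ K.faces) (hσA : σ ⊆ A) : A ⊆ K.tau σ h := by
  obtain ⟨μ, hμ, hAμ⟩ := K.exists_maximalFace hA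
  have hμτ : μ = K.tau σ h := h.2.choose_spec.2 μ ⟨hμ, hσA.trans hAμ⟩
  exact hμτ ▸ hAμ

/-- `K_σ = K \ [σ, τ(σ)]`: the complex obtained from `K` by collapsing the collapsible
face `σ`. -/
noncomputable def collapse (K : FiniteComplex V) (σ : Finset V) (h : K.IsCollapsibleFace σ) :
    FiniteComplex V where
  faces := K.faces \ K.interval σ (K.tau σ h)
  finite_faces := K.finite_faces.sdiff
  down_closed := fun A hA B hBA =>
    ⟨K.down_closed A hA.1 B hBA, fun hB =>
      hA.2 ⟨hA.1, hB.2.1.trans hBA, K.subset_tau σ h hA.1 (hB.2.1.trans hBA)⟩⟩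

/-- `K → K'`: the complex `K'` arises from `K` by an elementary `d`-collapse. -/
def ElementaryCollapse (d : ℕ) (K K' : FiniteComplex V) : Prop :=
  ∃ (σ : Finset V) (h : K.IsDCollapsibleFace d σ), K' = K.collapse σ h.1

/-- `K` `d`-collapses to `L`: there is a finite sequence of elementary `d`-collapses
from `K` to `L`. -/
def CollapsesTo (d : ℕ) (K L : FiniteComplex V) : Prop :=
  Relation.ReflTransGen (ElementaryCollapse d) K L

/-- `K` is `d`-collapsible: it `d`-collapses to the empty complex. -/
def IsDCollapsible (d : ℕ) (K : FiniteComplex V) : Prop :=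
  CollapsesTo d K (void V)

/-- `σ` is a good face: a `d`-collapsible face such that `K_σ` is `d`-collapsible. -/
def IsGoodFace (d : ℕ) (K : FiniteComplex V) (σ : Finset V) : Prop :=
  ∃ h : K.IsDCollapsibleFace d σ, IsDCollapsible d (K.collapse σ h.1)

/-- `σ` is a bad face: a `d`-collapsible face such that `K_σ` is not `d`-collapsible. -/
def IsBadFace (d : ℕ) (K : FiniteComplex V) (σ : Finset V) : Prop :=
  ∃ h : K.IsDCollapsibleFace d σ, ¬ IsDCollapsible d (K.collapse σ h.1)

end FiniteComplex

/-! Collapsing σ just deletes all faces containing σ (`del`), and an elementary `d`-collapse splits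
into collapses of faces with exactly `d` vertices and changes among smaller faces, which never
matter. So only `d`-sets need be collapsed (`isDCollapsible_iff_pureCollapsible`).

For `d ≤ 2`, take a counterexample with fewest faces: a bad free face κ with facet τ. If a good face
σ and a bad face ρ could be collapsed in either order, minimality would make ρ good
(`PureCollapsible.of_commute`). They do commute if each has just one vertex outside the other, so
good and bad faces are disjoint pairs. Now follow a sequence that removes all `d`-sets of K. As long
as it removes only good free faces inside τ, κ survives. The first removal of another kind is either
outside τ, and then commutes with κ, or of a bad face inside τ, which disjointness excludes.

For `d = 3`, two facets of a 4-simplex face can share a single vertex, and an explicit complex on 8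
vertices has the good face {0,1,2} and the bad face {0,3,4}. Collapsing the bad one leaves every
triangle in no tetrahedron alone, so nothing can be collapsed any more. Higher `d` follow by
attaching cones so that the stuck complex becomes its own suspension (`HasTrap.succ`). -/

namespace FiniteComplex

variable {V : Type*}

/-! ### Free faces and deletion -/

/-- The complex of those faces of `K` that do not contain `σ`. -/
def del (K : FiniteComplex V) (σ : Finset V) : FiniteComplex V where
  faces := {A | A ∈ K.faces ∧ ¬ σ ⊆ A}
  finite_faces := K.finite_faces.subset fun _ hA => hA.1
  down_closed := fun A hA B hBA =>
    ⟨K.down_closed A hA.1 B hBA, fun h => hA.2 (h.trans hBA)⟩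

/-- `τ` is a face of `K` that contains `σ` and every face of `K` containing `σ`. -/
def Free (K : FiniteComplex V) (σ τ : Finset V) : Prop :=
  σ ⊆ τ ∧ τ ∈ K.faces ∧ ∀ A ∈ K.faces, σ ⊆ A → A ⊆ τ

theorem mem_del {K : FiniteComplex V} {σ A : Finset V} :
    A ∈ (K.del σ).faces ↔ A ∈ K.faces ∧ ¬ σ ⊆ A := Iff.rfl

theorem ext_faces {K L : FiniteComplex V} (h : ∀ A, A ∈ K.faces ↔ A ∈ L.faces) : K = L :=
  FiniteComplex.ext (Set.ext h)

theorem del_comm (K : FiniteComplex V) (σ ρ : Finset V) :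
    (K.del σ).del ρ = (K.del ρ).del σ :=
  ext_faces fun A => by simp only [mem_del]; tauto

theorem del_del_of_subset (K : FiniteComplex V) {σ ρ : Finset V} (h : σ ⊆ ρ) :
    (K.del ρ).del σ = K.del σ :=
  ext_faces fun A => by
    simp only [mem_del]
    exact ⟨fun hA => ⟨hA.1.1, hA.2⟩, fun hA => ⟨⟨hA.1, fun h' => hA.2 (h.trans h')⟩, hA.2⟩⟩

theorem Free.mem {K : FiniteComplex V} {σ τ : Finset V} (h : K.Free σ τ) : σ ∈ K.faces :=
  K.down_closed τ h.2.1 σ h.1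

theorem Free.of_subset {K : FiniteComplex V} {σ τ ρ : Finset V} (h : K.Free σ τ) (hσ : σ ⊆ ρ)
    (hρ : ρ ⊆ τ) : K.Free ρ τ :=
  ⟨hρ, h.2.1, fun A hA hρA => h.2.2 A hA (hσ.trans hρA)⟩

theorem ncard_del_lt {K : FiniteComplex V} {σ : Finset V} (h : σ ∈ K.faces) :
    (K.del σ).faces.ncard < K.faces.ncard :=
  Set.ncard_lt_ncard ⟨fun _ hA => hA.1, fun hs => (hs h).2 subset_rfl⟩ K.finite_faces

theorem Free.isCollapsibleFace {K : FiniteComplex V} {σ τ : Finset V} (h : K.Free σ τ) :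
    K.IsCollapsibleFace σ :=
  ⟨h.mem, τ, ⟨⟨h.2.1, fun η hη hτ => (h.2.2 η hη (h.1.trans hτ)).antisymm hτ⟩, h.1⟩,
    fun μ hμ => (hμ.1.2 τ h.2.1 (h.2.2 μ hμ.1.1 hμ.2)).symm⟩

theorem IsCollapsibleFace.free {K : FiniteComplex V} {σ : Finset V}
    (h : K.IsCollapsibleFace σ) : K.Free σ (K.tau σ h) :=
  ⟨h.2.choose_spec.1.2, h.2.choose_spec.1.1.1, fun _ hA hσA => K.subset_tau σ h hA hσA⟩

theorem collapse_eq_del (K : FiniteComplex V) (σ : Finset V) (h : K.IsCollapsibleFace σ) :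
    K.collapse σ h = K.del σ :=
  ext_faces fun A => by
    constructor
    · exact fun hA => ⟨hA.1, fun hσ => hA.2 ⟨hA.1, hσ, K.subset_tau σ h hA.1 hσ⟩⟩
    · exact fun hA => ⟨hA.1, fun hI => hA.2 hI.2.1⟩

theorem dim_le_iff {σ : Finset V} {d : ℕ} : dim σ ≤ (d : ℤ) - 1 ↔ σ.card ≤ d := by
  unfold dim; omega

theorem elementaryCollapse_iff {d : ℕ} {K K' : FiniteComplex V} :
    ElementaryCollapse d K K' ↔ ∃ σ τ, K.Free σ τ ∧ σ.card ≤ d ∧ K' = K.del σ := by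
  constructor
  · rintro ⟨σ, h, rfl⟩
    exact ⟨σ, _, h.1.free, dim_le_iff.1 h.2, collapse_eq_del _ _ _⟩
  · rintro ⟨σ, τ, h, hd, rfl⟩
    exact ⟨σ, ⟨h.isCollapsibleFace, dim_le_iff.2 hd⟩, (collapse_eq_del _ _ _).symm⟩

theorem Free.collapsesTo {d : ℕ} {K : FiniteComplex V} {σ τ : Finset V} (h : K.Free σ τ)
    (hd : σ.card ≤ d) : CollapsesTo d K (K.del σ) :=
  .single (elementaryCollapse_iff.2 ⟨σ, τ, h, hd, rfl⟩)

theorem CollapsesTo.mono {d e : ℕ} (hde : d ≤ e) {K L : FiniteComplex V}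
    (h : CollapsesTo d K L) : CollapsesTo e K L := by
  refine Relation.ReflTransGen.mono (fun A B hAB => ?_) _ _ h
  obtain ⟨σ, τ, hf, hd, rfl⟩ := elementaryCollapse_iff.1 hAB
  exact elementaryCollapse_iff.2 ⟨σ, τ, hf, hd.trans hde, rfl⟩

/-- A complex of dimension less than `d` is `d`-collapsible. -/
theorem isDCollapsible_of_card_le {d : ℕ} (K : FiniteComplex V)
    (hK : ∀ A ∈ K.faces, A.card ≤ d) : K.IsDCollapsible d := by
  induction h : K.faces.ncard using Nat.strong_induction_on generalizing K with
  | _ n ih =>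
    subst h
    by_cases hne : ∃ A, A ∈ K.faces
    · obtain ⟨A, hA⟩ := hne
      obtain ⟨μ, hμ, -⟩ := K.exists_maximalFace hA
      have hf : K.Free μ μ := ⟨subset_rfl, hμ.1, fun A hA h => (hμ.2 A hA h).subset⟩
      exact (hf.collapsesTo (hK μ hμ.1)).trans
        (ih _ (ncard_del_lt hμ.1) (K.del μ) (fun A hA => hK A hA.1) rfl)
    · push Not at hne
      rw [show K = void V from ext_faces fun A => ⟨fun h => hne A h, fun h => h.elim⟩]
      exact .refl

/-! ### Reduction to collapses of faces with exactly `d` vertices -/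

/-- All faces of `K` with `d` vertices can be removed by elementary collapses of free faces with
exactly `d` vertices. -/
inductive PureCollapsible (d : ℕ) : FiniteComplex V → Prop
  | base (K : FiniteComplex V) (h : ∀ A ∈ K.faces, A.card ≠ d) : PureCollapsible d K
  | step (K : FiniteComplex V) (σ τ : Finset V) (hf : K.Free σ τ) (hd : σ.card = d)
      (h : PureCollapsible d (K.del σ)) : PureCollapsible d K

theorem PureCollapsible.isDCollapsible {d : ℕ} {K : FiniteComplex V}
    (h : PureCollapsible d K) : K.IsDCollapsible d := by
  induction h with
  | base K h =>
    refine isDCollapsible_of_card_le K fun A hA => ?_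
    by_contra! hlt
    obtain ⟨B, hB, hc⟩ := Finset.exists_subset_card_eq hlt.le
    exact h B (K.down_closed A hA B hB) hc
  | step K σ τ hf hd _ ih => exact (hf.collapsesTo hd.le).trans ih

/-- Freeness of a `d`-set involves only faces containing it, which have at least `d` vertices. -/
theorem PureCollapsible.congr {d : ℕ} {K L : FiniteComplex V} (h : PureCollapsible d K)
    (hKL : ∀ A, d ≤ A.card → (A ∈ K.faces ↔ A ∈ L.faces)) : PureCollapsible d L := by
  induction h generalizing L with
  | base K h => exact .base L fun A hA hd => h A ((hKL A hd.ge).2 hA) hd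
  | step K σ τ hf hd _ ih =>
    refine .step L σ τ ⟨hf.1, (hKL τ ?_).1 hf.2.1, fun A hA hσ => hf.2.2 A ((hKL A ?_).2 hA) hσ⟩
      hd (ih fun A hA => ?_)
    · exact hd ▸ Finset.card_le_card hf.1
    · exact hd ▸ Finset.card_le_card hσ
    · simp only [mem_del, hKL A hA]

/-- An elementary `d`-collapse is a composition of collapses of faces with exactly `d` vertices
and of modifications among the faces with fewer than `d` vertices. -/
theorem Free.rel_del {d : ℕ} (r : FiniteComplex V → FiniteComplex V → Prop)
    (htrans : ∀ K L M, r K L → r L M → r K M)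
    (hsmall : ∀ K L : FiniteComplex V,
      (∀ A, d ≤ A.card → (A ∈ K.faces ↔ A ∈ L.faces)) → r K L)
    (hpure : ∀ (K : FiniteComplex V) (σ τ : Finset V), K.Free σ τ → σ.card = d → r K (K.del σ))
    {K : FiniteComplex V} {σ τ : Finset V} (hf : K.Free σ τ) (hd : σ.card ≤ d) :
    r K (K.del σ) := by
  classical
  induction h : (τ \ σ).card using Nat.strong_induction_on generalizing K σ τ with
  | _ n ih =>
    subst h
    rcases hd.eq_or_lt with hd | hd
    · exact hpure K σ τ hf hd
    by_cases hτ : τ ⊆ σ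
    · refine hsmall _ _ fun A hA => ⟨fun h => ⟨h, fun hσ => ?_⟩, fun h => h.1⟩
      have := Finset.card_le_card ((hf.2.2 A h hσ).trans hτ)
      omega
    · obtain ⟨v, hv, hvσ⟩ := Finset.not_subset.1 hτ
      -- Collapsing σ ∪ {v} and then σ, whose facet has become τ \ {v}, amounts to collapsing σ;
      -- both intervals are shorter.
      have hsub : σ ⊆ insert v σ := Finset.subset_insert v σ
      have h1 : K.Free (insert v σ) τ := hf.of_subset hsub (Finset.insert_subset hv hf.1)
      have hlt : (τ \ insert v σ).card < (τ \ σ).card :=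
        Finset.card_lt_card ⟨Finset.sdiff_subset_sdiff subset_rfl hsub, fun hs =>
          (Finset.mem_sdiff.1 (hs (Finset.mem_sdiff.2 ⟨hv, hvσ⟩))).2
            (Finset.mem_insert_self v σ)⟩
      have h2 : (K.del (insert v σ)).Free σ (τ.erase v) := by
        refine ⟨Finset.subset_erase.2 ⟨hf.1, hvσ⟩,
          ⟨K.down_closed τ hf.2.1 _ (Finset.erase_subset v τ), fun hs =>
            Finset.notMem_erase v τ (hs (Finset.mem_insert_self v σ))⟩,
          fun A hA hσ => Finset.subset_erase.2 ⟨hf.2.2 A hA.1 hσ, fun hvA =>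
            hA.2 (Finset.insert_subset hvA hσ)⟩⟩
      have hlt' : (τ.erase v \ σ).card < (τ \ σ).card :=
        Finset.card_lt_card ⟨Finset.sdiff_subset_sdiff (Finset.erase_subset v τ) subset_rfl,
          fun hs => Finset.notMem_erase v τ
            (Finset.mem_sdiff.1 (hs (Finset.mem_sdiff.2 ⟨hv, hvσ⟩))).1⟩
      have hcard : (insert v σ).card ≤ d := (Finset.card_insert_le v σ).trans hd
      have := htrans _ _ _ (ih _ hlt h1 hcard rfl) (ih _ hlt' h2 hd.le rfl)
      rwa [del_del_of_subset K hsub] at this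

theorem Free.pureCollapsible_of_del {d : ℕ} {K : FiniteComplex V} {σ τ : Finset V}
    (hf : K.Free σ τ) (hd : σ.card ≤ d) : PureCollapsible d (K.del σ) → PureCollapsible d K :=
  hf.rel_del (r := fun K L => PureCollapsible d L → PureCollapsible d K)
    (fun _ _ _ h1 h2 h => h1 (h2 h)) (fun _ _ h hL => hL.congr fun A hA => (h A hA).symm)
    (fun K σ τ hf hd h => .step K σ τ hf hd h) hd

theorem isDCollapsible_iff_pureCollapsible {d : ℕ} {K : FiniteComplex V} :
    K.IsDCollapsible d ↔ PureCollapsible d K := by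
  refine ⟨fun h => ?_, PureCollapsible.isDCollapsible⟩
  refine Relation.ReflTransGen.head_induction_on h (.base _ fun A hA => hA.elim) ?_
  intro K L hKL _ ih
  obtain ⟨σ, τ, hf, hd, rfl⟩ := elementaryCollapse_iff.1 hKL
  exact hf.pureCollapsible_of_del hd ih

/-! ### Greedy collapsing for `d ≤ 2` -/

theorem Free.del_of_not_subset {K : FiniteComplex V} {σ τ ρ μ : Finset V} (hσ : K.Free σ τ)
    (hρ : K.Free ρ μ) (h : ¬ ρ ⊆ τ) : (K.del σ).Free ρ μ :=
  ⟨hρ.1, ⟨hρ.2.1, fun hs => h (hρ.1.trans (hσ.2.2 μ hρ.2.1 hs))⟩, fun A hA => hρ.2.2 A hA.1⟩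

/-- Any face containing ρ and a also contains σ, so deleting σ only strips a from the facet of ρ. -/
theorem Free.del_of_subset_insert [DecidableEq V] {K : FiniteComplex V} {σ ρ μ : Finset V} {a : V}
    (hρ : K.Free ρ μ) (haσ : a ∈ σ) (haρ : a ∉ ρ) (h : σ ⊆ insert a ρ) :
    (K.del σ).Free ρ (μ.erase a) :=
  ⟨Finset.subset_erase.2 ⟨hρ.1, haρ⟩,
    ⟨K.down_closed μ hρ.2.1 _ (Finset.erase_subset a μ), fun hs =>
      Finset.notMem_erase a μ (hs haσ)⟩,
    fun A hA hA' => Finset.subset_erase.2 ⟨hρ.2.2 A hA.1 hA', fun haA =>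
      hA.2 (h.trans (Finset.insert_subset haA hA'))⟩⟩

/-- This is where `d ≤ 2` enters: two triples may share exactly one vertex, which is neither
alternative. -/
theorem exists_subset_insert_or_disjoint [DecidableEq V] {d : ℕ} (hd2 : d ≤ 2) {σ ρ : Finset V}
    (hσ : σ.card = d) (hρ : ρ.card = d) (hne : σ ≠ ρ) :
    (∃ a ∈ σ, a ∉ ρ ∧ σ ⊆ insert a ρ) ∨ (d = 2 ∧ Disjoint σ ρ) := by
  have hns : ¬ σ ⊆ ρ := fun h => hne (Finset.eq_of_subset_of_card_le h (by omega))
  obtain ⟨a, ha, haρ⟩ := Finset.not_subset.1 hns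
  by_cases hs : σ ⊆ insert a ρ
  · exact .inl ⟨a, ha, haρ, hs⟩
  · obtain ⟨b, hb, hbρ⟩ := Finset.not_subset.1 hs
    rw [Finset.mem_insert, not_or] at hbρ
    have hab : ({a, b} : Finset V) ⊆ σ := by
      intro x hx
      rcases Finset.mem_insert.1 hx with rfl | hx
      · exact ha
      · exact Finset.mem_singleton.1 hx ▸ hb
    have hc : ({a, b} : Finset V).card = 2 := Finset.card_pair (Ne.symm hbρ.1)
    have hle := Finset.card_le_card hab
    have heq := Finset.eq_of_subset_of_card_le hab (by omega)
    refine .inr ⟨by omega, ?_⟩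
    rw [← heq, Finset.disjoint_insert_left, Finset.disjoint_singleton_left]
    exact ⟨haρ, hbρ.2⟩

/-- A good σ passes its goodness to ρ: ρ may be collapsed after σ by induction, and the same complex
is reached by collapsing ρ before σ. -/
theorem PureCollapsible.of_commute {d : ℕ} {K : FiniteComplex V} {σ ρ τ μ : Finset V}
    (ih : ∀ L : FiniteComplex V, L.faces.ncard < K.faces.ncard → PureCollapsible d L →
      ∀ σ τ, L.Free σ τ → σ.card = d → PureCollapsible d (L.del σ))
    (hσmem : σ ∈ K.faces) (hσ : σ.card = d) (hρ : ρ.card = d)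
    (h : PureCollapsible d (K.del σ)) (h1 : (K.del σ).Free ρ τ) (h2 : (K.del ρ).Free σ μ) :
    PureCollapsible d (K.del ρ) :=
  .step _ σ μ h2 hσ (del_comm K σ ρ ▸ ih _ (ncard_del_lt hσmem) h ρ τ h1 hρ)

/-- For `d ≤ 2`, a free `d`-set whose removal is harmless and one whose removal is harmful are
disjoint pairs. -/
theorem two_and_disjoint_of_good_of_bad {d : ℕ} (hd2 : d ≤ 2) {K : FiniteComplex V}
    {σ ρ τ μ : Finset V}
    (ih : ∀ L : FiniteComplex V, L.faces.ncard < K.faces.ncard → PureCollapsible d L →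
      ∀ σ τ, L.Free σ τ → σ.card = d → PureCollapsible d (L.del σ))
    (hσ : K.Free σ τ) (hρ : K.Free ρ μ) (hσd : σ.card = d) (hρd : ρ.card = d)
    (hgood : PureCollapsible d (K.del σ)) (hbad : ¬ PureCollapsible d (K.del ρ)) :
    d = 2 ∧ Disjoint σ ρ := by
  classical
  have hne : σ ≠ ρ := fun h => hbad (h ▸ hgood)
  rcases exists_subset_insert_or_disjoint hd2 hσd hρd hne with ⟨a, ha, ha', hs⟩ | h
  · rcases exists_subset_insert_or_disjoint hd2 hρd hσd hne.symm with ⟨b, hb, hb', hs'⟩ | h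
    · exact (hbad (.of_commute ih hσ.mem hσd hρd hgood (hρ.del_of_subset_insert ha ha' hs)
        (hσ.del_of_subset_insert hb hb' hs'))).elim
    · exact ⟨h.1, h.2.symm⟩
  · exact h

/-- For `d ≤ 2`, removing a free `d`-set keeps the removability of all `d`-sets. -/
theorem PureCollapsible.del {d : ℕ} (hd2 : d ≤ 2) {K : FiniteComplex V}
    (hK : PureCollapsible d K) {κ τ : Finset V} (hκ : K.Free κ τ) (hκd : κ.card = d) :
    PureCollapsible d (K.del κ) := by
  classical
  induction hn : K.faces.ncard using Nat.strong_induction_on generalizing K κ τ with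
  | _ n ih' =>
    subst hn
    have ih : ∀ L : FiniteComplex V, L.faces.ncard < K.faces.ncard → PureCollapsible d L →
        ∀ σ τ, L.Free σ τ → σ.card = d → PureCollapsible d (L.del σ) :=
      fun L hL hp σ τ hf hd => ih' _ hL hp hf hd rfl
    by_contra hbad
    -- N is the current complex of the sequence and F the faces removed so far, all good and free in
    -- K with facet τ. The last hypothesis says that the removals in F can be postponed until after
    -- that of a face outside τ.
    suffices H : ∀ N : FiniteComplex V, PureCollapsible d N → ∀ F : Set (Finset V),
        (∀ f ∈ F, K.Free f τ ∧ f.card = d ∧ PureCollapsible d (K.del f)) →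
        (∀ A, A ∈ N.faces ↔ A ∈ K.faces ∧ ∀ f ∈ F, ¬ f ⊆ A) →
        (∀ ρ, ¬ ρ ⊆ τ → PureCollapsible d (N.del ρ) → PureCollapsible d (K.del ρ)) → False from
      H K hK ∅ (by simp) (by simp) (fun _ _ h => h)
    intro N hN
    induction hN with
    | base N h =>
      intro F hF hNF _
      refine h κ ((hNF κ).2 ⟨hκ.mem, fun f hf hs => ?_⟩) hκd
      obtain ⟨h1, h2, h3⟩ := hF f hf
      exact hbad (Finset.eq_of_subset_of_card_le hs (by omega) ▸ h3)
    | step N ρ μ hρ hρd hNρ ihN =>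
      intro F hF hNF hout
      have hNK : ∀ A ∈ N.faces, A ∈ K.faces := fun A hA => ((hNF A).1 hA).1
      by_cases hρτ : ρ ⊆ τ
      · have hfree : K.Free ρ τ := by
          refine ⟨hρτ, hκ.2.1, fun A hA hρA => ?_⟩
          by_contra hAτ
          have hAN : A ∈ N.faces := (hNF A).2 ⟨hA, fun f hf hs =>
            hAτ ((hF f hf).1.2.2 A hA hs)⟩
          have hAμ := hρ.2.2 A hAN hρA
          -- A face of F inside ρ ∪ κ would avoid κ, hence lie in ρ. So ρ ∪ κ survives in N, which
          -- forces κ ⊆ μ ⊆ τ.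
          have hun : ρ ∪ κ ∈ N.faces := by
            refine (hNF _).2 ⟨K.down_closed τ hκ.2.1 _ (Finset.union_subset hρτ hκ.1),
              fun f hf hs => ?_⟩
            obtain ⟨h1, h2, h3⟩ := hF f hf
            have hdis := (two_and_disjoint_of_good_of_bad hd2 ih h1 hκ h2 hκd h3 hbad).2
            exact ((hNF ρ).1 hρ.mem).2 f hf (hdis.left_le_of_le_sup_right hs)
          have hκμ := Finset.subset_union_right.trans (hρ.2.2 _ hun Finset.subset_union_left)
          exact hAτ (hAμ.trans (hκ.2.2 μ (hNK μ hρ.2.1) hκμ))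
        by_cases hgood : PureCollapsible d (K.del ρ)
        · refine ihN (insert ρ F) ?_ ?_ ?_
          · rintro f (rfl | hf)
            · exact ⟨hfree, hρd, hgood⟩
            · exact hF f hf
          · intro A
            rw [mem_del, hNF, Set.forall_mem_insert]
            tauto
          · intro η hη hp
            refine hout η hη (.step _ ρ μ ⟨hρ.1, ⟨hρ.2.1, fun hs => hη (hs.trans ?_)⟩,
              fun A hA => hρ.2.2 A hA.1⟩ hρd (del_comm N ρ η ▸ hp))
            exact hfree.2.2 μ (hNK μ hρ.2.1) hρ.1
        · by_cases hFe : F = ∅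
          · refine hgood ?_
            rwa [show K = N from ext_faces fun A => by simp [hNF, hFe]]
          · obtain ⟨f, hf⟩ := Set.nonempty_iff_ne_empty.2 hFe
            -- With ρ bad, adding one vertex of f to ρ creates no face of F, as these are pairs
            -- disjoint from ρ. So μ would contain all of f, which was removed.
            refine ((hNF μ).1 hρ.2.1).2 f hf fun a ha => ?_
            refine hρ.2.2 (insert a ρ) ((hNF _).2 ⟨?_, fun g hg hs => ?_⟩)
              (Finset.subset_insert a ρ) (Finset.mem_insert_self a ρ)
            · exact K.down_closed τ hκ.2.1 _ (Finset.insert_subset ((hF f hf).1.1 ha) hρτ)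
            · obtain ⟨h1, h2, h3⟩ := hF g hg
              obtain ⟨hd, hdis⟩ := two_and_disjoint_of_good_of_bad hd2 ih h1 hfree h2 hρd h3 hgood
              have hga : g ⊆ {a} := by
                rw [Finset.insert_eq] at hs
                exact hdis.left_le_of_le_sup_right hs
              have := Finset.card_le_card hga
              rw [Finset.card_singleton] at this
              omega
      · have hfree : K.Free ρ μ :=
          ⟨hρ.1, hNK μ hρ.2.1, fun A hA hρA => hρ.2.2 A ((hNF A).2 ⟨hA, fun f hf hs =>
            hρτ (hρA.trans ((hF f hf).1.2.2 A hA hs))⟩) hρA⟩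
        have hκμ : ¬ κ ⊆ μ := fun h => hρτ (hρ.1.trans (hκ.2.2 μ hfree.2.1 h))
        exact hbad (.of_commute ih hfree.mem hρd hκd (hout ρ hρτ hNρ)
          (hfree.del_of_not_subset hκ hκμ) (hκ.del_of_not_subset hfree hρτ))

/-- For `d ≤ 2`, elementary `d`-collapses preserve `d`-collapsibility. -/
theorem IsDCollapsible.del {d : ℕ} (hd2 : d ≤ 2) {K : FiniteComplex V}
    (hK : K.IsDCollapsible d) {σ τ : Finset V} (hσ : K.Free σ τ) (hd : σ.card ≤ d) :
    (K.del σ).IsDCollapsible d := by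
  rw [isDCollapsible_iff_pureCollapsible] at hK ⊢
  exact hσ.rel_del (r := fun K L => PureCollapsible d K → PureCollapsible d L)
    (fun _ _ _ h1 h2 h => h2 (h1 h)) (fun _ _ h hK => hK.congr h)
    (fun _ _ _ hf hd hK => hK.del hd2 hf hd) hd hK

theorem IsDCollapsible.of_collapsesTo {d : ℕ} (hd2 : d ≤ 2) {K L : FiniteComplex V}
    (hK : K.IsDCollapsible d) (h : K.CollapsesTo d L) : L.IsDCollapsible d := by
  refine Relation.ReflTransGen.head_induction_on (motive := fun K _ =>
    K.IsDCollapsible d → L.IsDCollapsible d) h id ?_ hK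
  intro K M hKM _ ih hK
  obtain ⟨σ, τ, hf, hd, rfl⟩ := elementaryCollapse_iff.1 hKM
  exact ih (hK.del hd2 hf hd)



/-! ### Stuck complexes, cones and suspensions -/

/-- A nonempty complex without a free face of dimension less than `d`. -/
def Stuck (d : ℕ) (L : FiniteComplex V) : Prop :=
  ∅ ∈ L.faces ∧ ∀ σ τ, L.Free σ τ → d < σ.card

theorem Stuck.not_isDCollapsible {d : ℕ} {L : FiniteComplex V} (h : L.Stuck d) :
    ¬ L.IsDCollapsible d := by
  intro hL
  rcases Relation.ReflTransGen.cases_head hL with rfl | ⟨M, hM, -⟩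
  · exact h.1
  · obtain ⟨σ, τ, hf, hd, -⟩ := elementaryCollapse_iff.1 hM
    exact (h.2 σ τ hf).not_ge hd

section Cone

variable [DecidableEq V]

/-- The faces of `A` not containing `p`, together with the faces `insert p X` where `X` lies in
both `A` and `B`: for a new vertex `p` and `B ⊆ A`, the union of `A` and the cone over `B`. -/
def coneOver (p : V) (A B : FiniteComplex V) : FiniteComplex V where
  faces := {X | X.erase p ∈ A.faces ∧ (p ∈ X → X.erase p ∈ B.faces)}
  finite_faces := by
    refine (A.finite_faces.union (A.finite_faces.image (insert p))).subset fun X hX => ?_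
    by_cases hp : p ∈ X
    · exact .inr ⟨_, hX.1, Finset.insert_erase hp⟩
    · exact .inl (Finset.erase_eq_of_notMem hp ▸ hX.1)
  down_closed := fun X hX Y hYX =>
    ⟨A.down_closed _ hX.1 _ (Finset.erase_subset_erase p hYX), fun hp =>
      B.down_closed _ (hX.2 (hYX hp)) _ (Finset.erase_subset_erase p hYX)⟩

/-- `p` is not a vertex of `A`. -/
def IsNewVertex (p : V) (A : FiniteComplex V) : Prop := ∀ X ∈ A.faces, p ∉ X

variable {p q : V} {A B : FiniteComplex V} {ρ σ τ X : Finset V}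

theorem mem_coneOver :
    X ∈ (coneOver p A B).faces ↔ X.erase p ∈ A.faces ∧ (p ∈ X → X.erase p ∈ B.faces) := Iff.rfl

theorem mem_coneOver_of_notMem (h : p ∉ X) : X ∈ (coneOver p A B).faces ↔ X ∈ A.faces := by
  simp [mem_coneOver, h, Finset.erase_eq_of_notMem]

theorem insert_mem_coneOver (h : p ∉ X) :
    insert p X ∈ (coneOver p A B).faces ↔ X ∈ A.faces ∧ X ∈ B.faces := by
  simp [mem_coneOver, Finset.erase_insert h]

theorem subset_erase_iff (h : p ∉ ρ) : ρ ⊆ X.erase p ↔ ρ ⊆ X := by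
  simp [Finset.subset_erase, h]

theorem coneOver_void (h : IsNewVertex p A) : coneOver p A (void V) = A :=
  ext_faces fun X => by
    by_cases hp : p ∈ X
    · exact ⟨fun hX => (hX.2 hp).elim, fun hX => (h X hX hp).elim⟩
    · exact mem_coneOver_of_notMem hp

theorem del_coneOver (h : p ∉ ρ) :
    (coneOver p A B).del ρ = coneOver p (A.del ρ) (B.del ρ) :=
  ext_faces fun X => by simp only [mem_del, mem_coneOver, subset_erase_iff h]; tauto

theorem del_insert_coneOver (h : p ∉ ρ) :
    (coneOver p A B).del (insert p ρ) = coneOver p A (B.del ρ) :=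
  ext_faces fun X => by
    simp only [mem_del, mem_coneOver, subset_erase_iff h, Finset.insert_subset_iff]; tauto

theorem Free.coneOver (h : A.Free ρ τ) (hp : IsNewVertex p A) (hτ : τ ∈ B.faces) :
    (coneOver p A B).Free ρ (insert p τ) := by
  refine ⟨h.1.trans (Finset.subset_insert p τ),
    (insert_mem_coneOver (hp τ h.2.1)).2 ⟨h.2.1, hτ⟩, fun X hX hρ => ?_⟩
  rw [Finset.subset_insert_iff]
  exact h.2.2 _ hX.1 ((subset_erase_iff (hp ρ h.mem)).2 hρ)

theorem Free.coneOver_of_notMem (h : A.Free ρ τ) (hp : IsNewVertex p A) (hρ : ρ ∉ B.faces) :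
    (FiniteComplex.coneOver p A B).Free ρ τ := by
  refine ⟨h.1, (mem_coneOver_of_notMem (hp τ h.2.1)).2 h.2.1, fun X hX hρX => ?_⟩
  have hρX' := (subset_erase_iff (hp ρ h.mem)).2 hρX
  have hpX : p ∉ X := fun hpX => hρ (B.down_closed _ (hX.2 hpX) _ hρX')
  exact h.2.2 X ((mem_coneOver_of_notMem hpX).1 hX) hρX

theorem Free.insert_coneOver (h : B.Free ρ τ) (hBA : B.faces ⊆ A.faces) (hp : IsNewVertex p A) :
    (FiniteComplex.coneOver p A B).Free (insert p ρ) (insert p τ) := by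
  refine ⟨Finset.insert_subset_insert p h.1,
    (insert_mem_coneOver (hp τ (hBA h.2.1))).2 ⟨hBA h.2.1, h.2.1⟩, fun X hX hρ => ?_⟩
  rw [Finset.insert_subset_iff] at hρ
  rw [Finset.subset_insert_iff]
  exact h.2.2 _ (hX.2 hρ.1) ((subset_erase_iff (hp ρ (hBA h.mem))).2 hρ.2)

/-- The cone over `B` can be removed by the collapses of `B`, one dimension up. -/
theorem IsDCollapsible.coneOver_collapsesTo {d : ℕ} (h : B.IsDCollapsible d)
    (hBA : B.faces ⊆ A.faces) (hp : IsNewVertex p A) :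
    CollapsesTo (d + 1) (coneOver p A B) A := by
  refine Relation.ReflTransGen.head_induction_on (motive := fun B _ => B.faces ⊆ A.faces →
    CollapsesTo (d + 1) (FiniteComplex.coneOver p A B) A) h ?_ ?_ hBA
  · intro _
    rw [coneOver_void hp]
    exact .refl
  · intro B B' hB _ ih hBA
    obtain ⟨ρ, τ, hf, hd, rfl⟩ := elementaryCollapse_iff.1 hB
    have h1 := (hf.insert_coneOver hBA hp).collapsesTo (d := d + 1)
      ((Finset.card_insert_le p ρ).trans (by omega))
    rw [del_insert_coneOver (hp ρ (hBA hf.mem))] at h1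
    exact h1.trans (ih fun X hX => hBA hX.1)

/-- A cone over a `d`-collapsible complex is `d`-collapsible. -/
theorem IsDCollapsible.cone {d : ℕ} (h : A.IsDCollapsible d) (hp : IsNewVertex p A) :
    (coneOver p A A).IsDCollapsible d := by
  refine Relation.ReflTransGen.head_induction_on (motive := fun A _ => IsNewVertex p A →
    (FiniteComplex.coneOver p A A).IsDCollapsible d) h ?_ ?_ hp
  · intro h
    rw [coneOver_void h]
    exact .refl
  · intro A B hAB _ ih hp
    obtain ⟨ρ, τ, hf, hd, rfl⟩ := elementaryCollapse_iff.1 hAB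
    have h1 := (hf.coneOver hp hf.2.1).collapsesTo (d := d) hd
    rw [del_coneOver (hp ρ hf.mem)] at h1
    exact h1.trans (ih fun X hX => hp X hX.1)

/-- The suspension of a complex with suspension points `p` and `q`. -/
def suspension (p q : V) (L : FiniteComplex V) : FiniteComplex V :=
  coneOver p (coneOver q L L) L

theorem IsNewVertex.coneOver (h : IsNewVertex p A) (hpq : p ≠ q) :
    IsNewVertex p (coneOver q A B) := fun _ hX hpX =>
  h _ hX.1 (Finset.mem_erase.2 ⟨hpq, hpX⟩)

theorem mem_suspension {L : FiniteComplex V} (hq : IsNewVertex q L)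
    (hpq : p ≠ q) : X ∈ (suspension p q L).faces ↔
      (X.erase p).erase q ∈ L.faces ∧ ¬ (p ∈ X ∧ q ∈ X) := by
  unfold suspension
  simp only [mem_coneOver, Finset.mem_erase]
  constructor
  · rintro ⟨⟨h1, h2⟩, h3⟩
    exact ⟨h1, fun h => hq _ (h3 h.1) (Finset.mem_erase.2 ⟨hpq.symm, h.2⟩)⟩
  · rintro ⟨h1, h2⟩
    refine ⟨⟨h1, fun _ => h1⟩, fun h => ?_⟩
    rwa [Finset.erase_eq_of_notMem (a := q)
      fun hqX => h2 ⟨h, (Finset.mem_erase.1 hqX).2⟩] at h1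

theorem suspension_comm {L : FiniteComplex V} (hp : IsNewVertex p L) (hq : IsNewVertex q L)
    (hpq : p ≠ q) : suspension p q L = suspension q p L :=
  ext_faces fun X => by
    rw [mem_suspension hq hpq, mem_suspension hp hpq.symm, Finset.erase_right_comm]
    tauto

/-- The link of p in the suspension is `L`, so removing p from ρ leaves a free face of `L`. -/
theorem Stuck.lt_card_of_mem {d : ℕ} {L : FiniteComplex V} (h : L.Stuck d)
    (hf : (suspension p q L).Free ρ τ) (hp : IsNewVertex p L) (hpρ : p ∈ ρ) :
    d + 1 < ρ.card := by
  have hpτ := hf.1 hpρ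
  have hfree : L.Free (ρ.erase p) (τ.erase p) := by
    refine ⟨Finset.erase_subset_erase p hf.1, hf.2.1.2 hpτ, fun Y hY hρ => ?_⟩
    have hpY := hp Y hY
    have hqY : Y ∈ (FiniteComplex.coneOver q L L).faces :=
      ⟨L.down_closed Y hY _ (Finset.erase_subset q Y), fun _ =>
        L.down_closed Y hY _ (Finset.erase_subset q Y)⟩
    have := hf.2.2 (insert p Y) ((insert_mem_coneOver hpY).2 ⟨hqY, hY⟩)
      ((Finset.subset_insert_iff).2 hρ)
    exact Finset.subset_erase.2 ⟨(Finset.subset_insert p Y).trans this, hpY⟩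
  have := h.2 _ _ hfree
  rw [Finset.card_erase_of_mem hpρ] at this
  omega

/-- A face avoiding both suspension points is never free: its facet would have to contain both. -/
theorem Stuck.suspension {d : ℕ} {L : FiniteComplex V} (h : L.Stuck d) (hp : IsNewVertex p L)
    (hq : IsNewVertex q L) (hpq : p ≠ q) : (suspension p q L).Stuck (d + 1) := by
  refine ⟨(mem_suspension hq hpq).2 (by simpa using h.1), fun ρ τ hf => ?_⟩
  by_cases hpρ : p ∈ ρ
  · exact h.lt_card_of_mem hf hp hpρ
  by_cases hqρ : q ∈ ρ
  · exact h.lt_card_of_mem (suspension_comm hp hq hpq ▸ hf) hq hqρ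
  have hρ := ((mem_suspension hq hpq).1 hf.mem).1
  rw [Finset.erase_eq_of_notMem hpρ, Finset.erase_eq_of_notMem hqρ] at hρ
  have hpτ : p ∈ τ := hf.2.2 (insert p ρ) ((mem_suspension hq hpq).2
    ⟨by simpa [Finset.erase_insert hpρ, Finset.erase_eq_of_notMem hqρ] using hρ,
      by simp [hpq.symm, hqρ]⟩) (Finset.subset_insert p ρ) (Finset.mem_insert_self p ρ)
  have hqτ : q ∈ τ := hf.2.2 (insert q ρ) ((mem_suspension hq hpq).2
    ⟨by simpa [Finset.erase_right_comm (a := p), Finset.erase_insert hqρ,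
      Finset.erase_eq_of_notMem hpρ] using hρ,
      by simp [hpq, hpρ]⟩) (Finset.subset_insert q ρ) (Finset.mem_insert_self q ρ)
  exact (((mem_suspension hq hpq).1 hf.2.1).2 ⟨hpτ, hqτ⟩).elim

end Cone

/-! ### Raising the dimension of a bad face -/

theorem exists_isNewVertex [Infinite V] (A : FiniteComplex V) (s : Finset V) :
    ∃ p, IsNewVertex p A ∧ p ∉ s := by
  classical
  obtain ⟨p, hp⟩ := Infinite.exists_notMem_finset (A.finite_faces.toFinset.sup id ∪ s)
  rw [Finset.notMem_union] at hp
  exact ⟨p, fun X hX hpX => hp.1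
    (Finset.mem_sup.2 ⟨X, A.finite_faces.mem_toFinset.2 hX, hpX⟩), hp.2⟩

/-- `K` is `d`-collapsible, and collapsing the face `σ` with at most `d` vertices leads to a
complex without free faces of dimension less than `d` that is `(d + 1)`-collapsible. -/
structure HasTrap (d : ℕ) (K : FiniteComplex V) (σ τ : Finset V) : Prop where
  free : K.Free σ τ
  card_le : σ.card ≤ d
  collapsible : K.IsDCollapsible d
  stuck : (K.del σ).Stuck d
  collapsible_succ : (K.del σ).IsDCollapsible (d + 1)

/-- The new complex is K with a cone from p over all of K and a cone from q over K \ σ. Collapsing σ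
at once yields the suspension of K \ σ, which is stuck. Removing the cone from p first, by the
collapses of K one dimension up, and then σ leaves a cone over K \ σ, which is (d + 1)-collapsible.
-/
theorem HasTrap.succ [Infinite V] {d : ℕ} {K : FiniteComplex V} {σ τ : Finset V}
    (h : K.HasTrap d σ τ) : ∃ (K' : FiniteComplex V) (τ' : Finset V), K'.HasTrap (d + 1) σ τ' := by
  classical
  obtain ⟨p, hp, -⟩ := K.exists_isNewVertex ∅
  obtain ⟨q, hq, hqp⟩ := K.exists_isNewVertex {p}
  have hpq : p ≠ q := fun h => hqp (h ▸ Finset.mem_singleton_self p)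
  have hσ := h.free.mem
  have hpL : IsNewVertex p (K.del σ) := fun X hX => hp X hX.1
  have hqL : IsNewVertex q (K.del σ) := fun X hX => hq X hX.1
  have hdd : (K.del σ).del σ = K.del σ := del_del_of_subset K subset_rfl
  have hM : (coneOver q K (K.del σ)).Free σ τ :=
    h.free.coneOver_of_notMem hq fun hs => hs.2 subset_rfl
  have hpM : IsNewVertex p (coneOver q K (K.del σ)) := hp.coneOver hpq
  have hdM : (coneOver q K (K.del σ)).del σ = coneOver q (K.del σ) (K.del σ) := by
    rw [del_coneOver (hq σ hσ), hdd]
  have hdK : (coneOver p (coneOver q K (K.del σ)) K).del σ = suspension p q (K.del σ) := by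
    rw [del_coneOver (hp σ hσ), hdM, suspension]
  have hcone : (coneOver q (K.del σ) (K.del σ)).IsDCollapsible (d + 1) :=
    h.collapsible_succ.cone hqL
  refine ⟨coneOver p (coneOver q K (K.del σ)) K, insert p τ, hM.coneOver hpM h.free.2.1,
    h.card_le.trans (Nat.le_succ d), ?_, ?_, ?_⟩
  · have h1 := h.collapsible.coneOver_collapsesTo
      (fun X hX => (mem_coneOver_of_notMem (hq X hX)).2 hX) hpM
    have h2 := hM.collapsesTo (d := d + 1) (h.card_le.trans (Nat.le_succ d))
    exact h1.trans (h2.trans (hdM ▸ hcone))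
  · exact hdK ▸ h.stuck.suspension hpL hqL hpq
  · rw [hdK]
    have h1 := h.collapsible_succ.coneOver_collapsesTo (p := p)
      (A := coneOver q (K.del σ) (K.del σ))
      (fun X hX => (mem_coneOver_of_notMem (hqL X hX)).2 hX) (hpL.coneOver hpq)
    exact h1.trans (hcone.mono (Nat.le_succ _))

/-! ### The example for `d = 3` -/

/-- The complex generated by a list of facets. -/
def generated (F : List (Finset V)) : FiniteComplex V where
  faces := {A | ∃ q ∈ F, A ⊆ q}
  finite_faces := by
    refine (F.finite_toSet.biUnion (t := fun q => {A | A ⊆ q}) fun q _ =>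
      q.powerset.finite_toSet.subset fun A hA => Finset.mem_powerset.2 hA).subset ?_
    rintro A ⟨q, hq, hA⟩
    exact Set.mem_biUnion hq hA
  down_closed := fun _ ⟨q, hq, hA⟩ _ hB => ⟨q, hq, hB.trans hA⟩

theorem mem_generated {F : List (Finset V)} {A : Finset V} :
    A ∈ (generated F).faces ↔ ∃ q ∈ F, A ⊆ q := Iff.rfl

theorem free_generated_cons {F : List (Finset V)} {σ τ : Finset V} (h : σ ⊆ τ)
    (hF : ∀ q ∈ F, ¬ σ ⊆ q) : (generated (τ :: F)).Free σ τ := by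
  refine ⟨h, ⟨τ, List.mem_cons_self, subset_rfl⟩, ?_⟩
  rintro A ⟨q, hq, hA⟩ hσ
  rcases List.mem_cons.1 hq with rfl | hq
  · exact hA
  · exact (hF q hq (hσ.trans hA)).elim

theorem del_generated_cons [DecidableEq V] {F : List (Finset V)} {τ : Finset V} {l : List V}
    (hF : ∀ q ∈ F, ¬ l.toFinset ⊆ q) :
    (generated (τ :: F)).del l.toFinset = generated (l.map (τ.erase ·) ++ F) := by
  refine ext_faces fun A => ?_
  simp only [mem_del, mem_generated, List.mem_append, List.mem_map, List.mem_cons]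
  constructor
  · rintro ⟨⟨q, rfl | hq, hA⟩, hl⟩
    · obtain ⟨v, hv, hvA⟩ := Finset.not_subset.1 hl
      exact ⟨_, .inl ⟨v, List.mem_toFinset.1 hv, rfl⟩, Finset.subset_erase.2 ⟨hA, hvA⟩⟩
    · exact ⟨q, .inr hq, hA⟩
  · rintro ⟨q, ⟨v, hv, rfl⟩ | hq, hA⟩
    · exact ⟨⟨τ, .inl rfl, hA.trans (Finset.erase_subset v τ)⟩, fun hl =>
        Finset.notMem_erase v τ (hA (hl (List.mem_toFinset.2 hv)))⟩
    · exact ⟨⟨q, .inr hq, hA⟩, fun hl => hF q hq (hl.trans hA)⟩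

/-- A complex of dimension at most `d` is `d`-collapsible if its `d`-dimensional faces can be
listed, each with a facet that lies in none of the later faces of the list. -/
theorem isDCollapsible_of_pairwise {d : ℕ} (l : List (Finset V × Finset V))
    (hl : ∀ x ∈ l, x.1 ⊆ x.2 ∧ x.1.card = d ∧ x.2.card = d + 1)
    (hpair : l.Pairwise fun x y => ¬ x.1 ⊆ y.2) (K : FiniteComplex V)
    (hK : ∀ A ∈ K.faces, A.card ≤ d ∨ ∃ x ∈ l, x.2 = A) : K.IsDCollapsible d := by
  induction l generalizing K with
  | nil => exact isDCollapsible_of_card_le K (by simpa using hK)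
  | cons x l ih =>
    rw [List.pairwise_cons] at hpair
    have hl' := fun y hy => hl y (List.mem_cons_of_mem x hy)
    obtain ⟨h1, h2, h3⟩ := hl x List.mem_cons_self
    by_cases hx : x.2 ∈ K.faces
    · have hf : K.Free x.1 x.2 := by
        refine ⟨h1, hx, fun A hA hxA => ?_⟩
        rcases hK A hA with hc | ⟨y, hy, rfl⟩
        · rwa [← Finset.eq_of_subset_of_card_le hxA (by omega)]
        · rcases List.mem_cons.1 hy with rfl | hy
          · exact subset_rfl
          · exact (hpair.1 y hy hxA).elim
      refine (hf.collapsesTo h2.le).trans (ih hl' hpair.2 _ fun A hA => ?_)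
      rcases hK A hA.1 with hc | ⟨y, hy, rfl⟩
      · exact .inl hc
      · rcases List.mem_cons.1 hy with rfl | hy
        · exact (hA.2 h1).elim
        · exact .inr ⟨y, hy, rfl⟩
    · refine ih hl' hpair.2 K fun A hA => ?_
      rcases hK A hA with hc | ⟨y, hy, rfl⟩
      · exact .inl hc
      · rcases List.mem_cons.1 hy with rfl | hy
        · exact (hx hA).elim
        · exact .inr ⟨y, hy, rfl⟩

/-- A pure complex of dimension `d` is stuck if every `(d - 1)`-dimensional face lies in at least
two `d`-dimensional ones. -/
theorem stuck_generated [DecidableEq V] {d : ℕ} {F : List (Finset V)} (hne : F ≠ [])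
    (hcard : ∀ q ∈ F, q.card = d + 1)
    (h : ∀ q ∈ F, ∀ v ∈ q, ∃ q' ∈ F, q' ≠ q ∧ q.erase v ⊆ q') : (generated F).Stuck d := by
  obtain ⟨q₀, hq₀⟩ := List.exists_mem_of_ne_nil F hne
  refine ⟨⟨q₀, hq₀, Finset.empty_subset q₀⟩, fun σ τ hf => ?_⟩
  by_contra! hd
  obtain ⟨q, hq, hτq⟩ := hf.2.1
  have hqτ := hf.2.2 q ⟨q, hq, subset_rfl⟩ (hf.1.trans hτq)
  have hqd := hcard q hq
  -- A free σ with at most d vertices misses a vertex v of its facet q, so it also lies in the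
  -- second facet containing q \ {v}.
  obtain ⟨v, hv, hvσ⟩ := Finset.exists_mem_notMem_of_card_lt_card
    (show σ.card < q.card by omega)
  obtain ⟨q', hq', hne', hs⟩ := h q hq v hv
  have hσq' : σ ⊆ q' := (Finset.subset_erase.2 ⟨hf.1.trans hτq, hvσ⟩).trans hs
  have := (hf.2.2 q' ⟨q', hq', subset_rfl⟩ hσq').trans hτq
  exact hne' (Finset.eq_of_subset_of_card_le this (by rw [hqd, hcard q' hq']))

/-- Tetrahedra that, glued to the simplex on `{0, 1, 2, 3, 4}`, form a complex in which `{0, 1, 2}`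
is a good and `{0, 3, 4}` a bad free face. -/
def trapTetrahedra : List (Finset ℕ) :=
  [{1, 2, 3, 5}, {0, 1, 4, 5}, {0, 2, 4, 5}, {2, 3, 4, 5}, {0, 1, 3, 6}, {1, 3, 4, 6},
    {0, 1, 5, 6}, {1, 2, 5, 6}, {0, 3, 5, 6}, {2, 3, 5, 6}, {1, 4, 5, 6}, {3, 4, 5, 6},
    {0, 2, 3, 7}, {0, 2, 5, 7}, {1, 2, 5, 7}, {0, 3, 5, 7}, {1, 3, 5, 7}, {1, 2, 6, 7},
    {1, 3, 6, 7}, {2, 3, 6, 7}]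

/-- An order in which the tetrahedra can be removed once `{0, 1, 2}` has been collapsed, each with
the triangle used for it. -/
def trapOrder : List (Finset ℕ × Finset ℕ) :=
  [({1, 2, 4}, {1, 2, 3, 4}), ({1, 2, 3}, {1, 2, 3, 5}), ({1, 3, 5}, {1, 3, 5, 7}),
    ({1, 5, 7}, {1, 2, 5, 7}), ({1, 2, 5}, {1, 2, 5, 6}), ({2, 5, 6}, {2, 3, 5, 6}),
    ({2, 3, 5}, {2, 3, 4, 5}), ({2, 3, 4}, {0, 2, 3, 4}), ({0, 3, 4}, {0, 1, 3, 4}),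
    ({0, 1, 4}, {0, 1, 4, 5}), ({2, 4, 5}, {0, 2, 4, 5}), ({0, 1, 3}, {0, 1, 3, 6}),
    ({1, 3, 4}, {1, 3, 4, 6}), ({0, 1, 6}, {0, 1, 5, 6}), ({0, 5, 6}, {0, 3, 5, 6}),
    ({1, 5, 6}, {1, 4, 5, 6}), ({4, 5, 6}, {3, 4, 5, 6}), ({0, 2, 3}, {0, 2, 3, 7}),
    ({2, 5, 7}, {0, 2, 5, 7}), ({3, 5, 7}, {0, 3, 5, 7}), ({1, 2, 7}, {1, 2, 6, 7}),
    ({1, 6, 7}, {1, 3, 6, 7}), ({3, 6, 7}, {2, 3, 6, 7})]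

theorem hasTrap_three :
    (generated ({0, 1, 2, 3, 4} :: trapTetrahedra)).HasTrap 3 {0, 3, 4} {0, 1, 2, 3, 4} := by
  have hbad : (generated ({0, 1, 2, 3, 4} :: trapTetrahedra)).del {0, 3, 4} =
      generated ([0, 3, 4].map (Finset.erase {0, 1, 2, 3, 4}) ++ trapTetrahedra) :=
    del_generated_cons (l := [0, 3, 4]) (by decide +kernel)
  have hgood : (generated ({0, 1, 2, 3, 4} :: trapTetrahedra)).del {0, 1, 2} =
      generated ([0, 1, 2].map (Finset.erase {0, 1, 2, 3, 4}) ++ trapTetrahedra) :=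
    del_generated_cons (l := [0, 1, 2]) (by decide +kernel)
  refine ⟨free_generated_cons (by decide) (by decide +kernel), by decide, ?_, ?_, ?_⟩
  · have hf : (generated ({0, 1, 2, 3, 4} :: trapTetrahedra)).Free {0, 1, 2} {0, 1, 2, 3, 4} :=
      free_generated_cons (by decide) (by decide +kernel)
    refine (hf.collapsesTo (d := 3) (by decide)).trans ?_
    rw [hgood]
    refine isDCollapsible_of_pairwise trapOrder (by decide +kernel) (by decide +kernel) _ ?_
    rintro A ⟨q, hq, hA⟩
    have hq' : q.card = 4 ∧ ∃ x ∈ trapOrder, x.2 = q := by clear hA; revert q; decide +kernel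
    by_cases hc : A.card ≤ 3
    · exact .inl hc
    · exact .inr (Finset.eq_of_subset_of_card_le hA (by omega) ▸ hq'.2)
  · rw [hbad]
    exact stuck_generated (by simp) (by decide +kernel) (by decide +kernel)
  · rw [hbad]
    -- Once the 4-simplex is gone, no face has more than four vertices.
    refine isDCollapsible_of_card_le _ ?_
    rintro A ⟨q, hq, hA⟩
    have hq' : q.card ≤ 4 := by clear hA; revert q; decide +kernel
    exact (Finset.card_le_card hA).trans hq'

theorem exists_hasTrap {d : ℕ} (hd : 3 ≤ d) :
    ∃ (K : FiniteComplex ℕ) (σ τ : Finset ℕ), K.HasTrap d σ τ := by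
  induction d, hd using Nat.le_induction with
  | base => exact ⟨_, _, _, hasTrap_three⟩
  | succ d _ ih =>
    obtain ⟨K, σ, τ, h⟩ := ih
    obtain ⟨K', τ', h'⟩ := h.succ
    exact ⟨K', σ, τ', h'⟩

end FiniteComplex

theorem theorem2 :
    (∀ d : ℕ, d ≤ 2 → ∀ (V : Type*) (K : FiniteComplex V), K.IsDCollapsible d →
      (∀ σ : Finset V, K.IsDCollapsibleFace d σ → K.IsGoodFace d σ) ∧
      (∀ L : FiniteComplex V, K.CollapsesTo d L → L.IsDCollapsible d)) ∧
    (∀ d : ℕ, 3 ≤ d → ∃ (V : Type) (K : FiniteComplex V), K.IsDCollapsible d ∧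
      ∃ σ : Finset V, K.IsBadFace d σ) := by
  refine ⟨fun d hd V K hK => ⟨fun σ hσ => ⟨hσ, ?_⟩, fun L hL => hK.of_collapsesTo hd hL⟩,
    fun d hd => ?_⟩
  · exact hK.of_collapsesTo hd (.single ⟨σ, hσ, rfl⟩)
  · obtain ⟨K, σ, τ, h⟩ := FiniteComplex.exists_hasTrap hd
    refine ⟨ℕ, K, h.collapsible, σ,
      ⟨h.free.isCollapsibleFace, FiniteComplex.dim_le_iff.2 h.card_le⟩, ?_⟩
    rw [FiniteComplex.collapse_eq_del]
    exact h.stuck.not_isDCollapsible
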